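/- Let $n\ge 8$ be even. On the space $(\mathbb{C}^2)^{\otimes n}$ of $n$ fermi modes with standard basis $|x\rangle$, $x\in\{0,1\}^n$, let $a_j=Z_1\cdots Z_{j-1}\,|0\rangle\langle 1|_j$ ($1\le j\le n$) be the annihilation operators, where $Z_i$ is the Pauli $Z$ operator on the $i$-th factor, and let $c_{2p-1}=a_p+a_p^\dagger$, $c_{2p}=(-i)(a_p-a_p^\dagger)$ ($1\le p\le n$) be the Majorana operators. Richardson's Hamiltonian is $$h=P^\dagger P,\qquad P=\sum_{j=1}^{n/2}a_{2j-1}a_{2j}.$$ A state is called Gaussian if it has the form $U|0^n\rangle$ with $U$ a unitary operator such that, for some orthogonal matrix $R\in O(2n)$, $U^\dagger c_pU=\sum_{q=1}^{2n}R_{p,q}c_q$ for all $p=1,\dots,2n$. Let $\lambda_{\mathrm{gauss}}(h)=\max_\psi\langle\psi|h|\psi\rangle$, where the maximum is over all Gaussian states $\psi$ (and is attained), and let $\lambda_{\max}(h)$ be the largest eigenvalue of $h$. Then $$\frac{\lambda_{\mathrm{gauss}}(h)}{\lambda_{\max}(h)}\ge 1-\frac6n .$$ -/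

import Mathlib

open scoped Matrix

namespace Fermion

noncomputable section

/-- Labels `x ∈ {0,1}ⁿ` of the standard basis of the space of `n` fermi modes
(identified with `n` qubits); `true` means that the mode is occupied. -/
abbrev Occ (n : ℕ) : Type := Fin n → Bool

/-- Operators on the `2ⁿ`-dimensional space of `n` fermi modes, in the standard basis. -/
abbrev Op (n : ℕ) : Type := Matrix (Occ n) (Occ n) ℂ

/-- State vectors of `n` fermi modes, in the standard basis. -/
abbrev Ket (n : ℕ) : Type := Occ n → ℂ

/-- The operator `|0⟩⟨1|` acting on the `j`-th qubit. -/
def lower {n : ℕ} (j : Fin n) : Op n :=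
  Matrix.of fun x y => if y j = true ∧ x = Function.update y j false then 1 else 0

/-- The operator `Z_1 ⋯ Z_{j-1}` (the product of the Pauli `Z` on all qubits before `j`). -/
def zString {n : ℕ} (j : Fin n) : Op n :=
  Matrix.diagonal fun x => ∏ i ∈ Finset.univ.filter (fun i => i < j), if x i = true then -1 else 1

/-- The annihilation operator `a_j = Z_1 ⋯ Z_{j-1} |0⟩⟨1|_j`. Modes are numbered from `0`. -/
def ann {n : ℕ} (j : Fin n) : Op n := zString j * lower j

/-- The Majorana operators: with modes and operators numbered from `0`,
`c_{2p} = a_p + a_p†` and `c_{2p+1} = (-i)(a_p - a_p†)`. -/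
def majorana {n : ℕ} (k : Fin (2 * n)) : Op n :=
  let p : Fin n := ⟨k.1 / 2, by omega⟩
  if k.1 % 2 = 0 then ann p + (ann p)ᴴ else (-Complex.I) • (ann p - (ann p)ᴴ)

/-- The vacuum `|0ⁿ⟩`. -/
def vacuum (n : ℕ) : Ket n := Pi.single (fun _ => false) 1

/-- A state is Gaussian if it is `U |0ⁿ⟩` for a unitary `U` with
`U† c_p U = ∑_q R_{p,q} c_q` for all `p`, for some orthogonal matrix `R ∈ O(2n)`. -/
def IsGaussian {n : ℕ} (ψ : Ket n) : Prop :=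
  ∃ R ∈ Matrix.orthogonalGroup (Fin (2 * n)) ℝ, ∃ U ∈ Matrix.unitaryGroup (Occ n) ℂ,
    (∀ p, Uᴴ * majorana p * U = ∑ q, ((R p q : ℝ) : ℂ) • majorana q) ∧
    ψ = U *ᵥ vacuum n

/-- The energy `⟨ψ|h|ψ⟩` (a real number when `h` is Hermitian). -/
def energy {n : ℕ} (h : Op n) (ψ : Ket n) : ℝ := (star ψ ⬝ᵥ (h *ᵥ ψ)).re

/-- The set of energies of Gaussian states. -/
def gaussianEnergies {n : ℕ} (h : Op n) : Set ℝ := {x | ∃ ψ, IsGaussian ψ ∧ energy h ψ = x}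

/-- `λ_gauss(h)`, the maximal energy over Gaussian states. -/
def lambdaGauss {n : ℕ} (h : Op n) : ℝ := sSup (gaussianEnergies h)

/-- The set of (real) eigenvalues of `h`. -/
def realEigenvalues {n : ℕ} (h : Op n) : Set ℝ :=
  {x | Module.End.HasEigenvalue (Matrix.toLin' h) (x : ℂ)}

/-- `λ_max(h)`, the largest eigenvalue of a Hermitian operator `h`. -/
def lambdaMax {n : ℕ} (h : Op n) : ℝ := sSup (realEigenvalues h)

/-- The pair operator `P = ∑_j a_{2j} a_{2j+1}`, `0 ≤ j < n/2`, with modes numbered from `0`. -/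
def pairOp (n : ℕ) : Op n :=
  ∑ j : Fin (n / 2), ann (⟨2 * j.1, by omega⟩ : Fin n) * ann (⟨2 * j.1 + 1, by omega⟩ : Fin n)

/-- Richardson's Hamiltonian `h = P† P`. -/
def richardson (n : ℕ) : Op n := (pairOp n)ᴴ * pairOp n

end

end Fermion

/-!
The proof compares both sides with the number `N = n / 2` of pairs of modes.

In the occupation basis the pair annihilator `a_{2j} a_{2j+1}` carries no Jordan–Wigner string: up
to one common sign it turns the full pair `j` into an empty one. So the matrix of `h = P† P` has
entries that are non-negative integers, and the row of a pattern with `D` full and `E` empty pairs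
has sum `D (E + 1) ≤ (N + 1)² / 4` (`card_fullPair_mul_le`). The largest row sum bounds every
eigenvalue (`realEigenvalue_le`).

For the lower bound take the BCS state in which each pair is in the state `(|00⟩ + |11⟩) / √2`. It
is Gaussian, since the unitary `(1 + c_k c_l) / √2` acts on the Majorana operators by a signed
permutation, and one such unitary per pair, with `c_k` and `c_l` from the two modes of the pair,
produces it from the vacuum (`exists_isGaussianUnitary_mulVec_vacuum`). This state satisfies
`P ψ = -E ψ`, where `E` counts the empty pairs of a pattern. As `E` has mean `N / 2`, the energy,
which is the mean of `E²`, is at least `N² / 4` (`exists_gaussian_energy_ge`). The bound follows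
from `N² / (N + 1)² ≥ 1 - 3 / N`.

The Gaussian maximum is attained since the pairs `(R, U)` that define Gaussian states form a closed
subset of the compact set `O(2n) × U(2ⁿ)`. The largest eigenvalue is attained since the spectrum is
finite, and it is positive since `h` is positive semidefinite and not zero.
-/

namespace Fermion

/-! ### Majorana operators in the occupation basis -/

/-- The occupation pattern obtained from `x` by changing the occupation of mode `p`. -/
def flipAt {n : ℕ} (p : Fin n) (x : Occ n) : Occ n := Function.update x p (!x p)

/-- The Jordan–Wigner sign: the parity of the number of occupied modes among the first `m`. -/
def jwSign {n : ℕ} (m : ℕ) (x : Occ n) : ℂ :=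
  ∏ i : Fin n with i.1 < m, if x i = true then -1 else 1

theorem flipAt_flipAt {n : ℕ} (p : Fin n) (x : Occ n) : flipAt p (flipAt p x) = x := by
  simp [flipAt]

theorem flipAt_comm {n : ℕ} (p q : Fin n) (x : Occ n) :
    flipAt p (flipAt q x) = flipAt q (flipAt p x) := by
  rcases eq_or_ne p q with rfl | h
  · rfl
  · simp only [flipAt, Function.update_of_ne h, Function.update_of_ne h.symm]
    exact Function.update_comm h.symm _ _ _

theorem jwSign_mul_self {n : ℕ} (m : ℕ) (x : Occ n) : jwSign m x * jwSign m x = 1 := by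
  rw [jwSign, ← Finset.prod_mul_distrib]
  refine Finset.prod_eq_one fun i _ => ?_
  split_ifs <;> norm_num

theorem star_jwSign {n : ℕ} (m : ℕ) (x : Occ n) : star (jwSign m x) = jwSign m x := by
  rw [jwSign, star_prod]
  refine Finset.prod_congr rfl fun i _ => ?_
  split_ifs <;> simp

theorem jwSign_update_of_le {n : ℕ} {m : ℕ} {p : Fin n} (h : m ≤ p) (b : Bool) (x : Occ n) :
    jwSign m (Function.update x p b) = jwSign m x := by
  refine Finset.prod_congr rfl fun i hi => ?_
  have : i ≠ p := by
    rintro rfl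
    simp at hi
    omega
  rw [Function.update_of_ne this]

theorem jwSign_flipAt {n : ℕ} (m : ℕ) (p : Fin n) (x : Occ n) :
    jwSign m (flipAt p x) = (if p.1 < m then -1 else 1) * jwSign m x := by
  split_ifs with h
  · have hp : p ∈ Finset.univ.filter (fun i : Fin n => i.1 < m) := by simpa using h
    rw [jwSign, jwSign, ← Finset.mul_prod_erase _ _ hp, ← Finset.mul_prod_erase _ _ hp,
      ← mul_assoc]
    congr 1
    · cases hx : x p <;> simp [flipAt, hx]
    · refine Finset.prod_congr rfl fun i hi => ?_
      rw [flipAt, Function.update_of_ne (Finset.ne_of_mem_erase hi)]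
  · rw [one_mul, flipAt, jwSign_update_of_le (not_lt.mp h)]

theorem jwSign_succ {n : ℕ} (p : Fin n) (x : Occ n) :
    jwSign (p.1 + 1) x = (if x p = true then -1 else 1) * jwSign p.1 x := by
  have : (Finset.univ.filter fun i : Fin n => i.1 < p.1 + 1)
      = insert p (Finset.univ.filter fun i : Fin n => i.1 < p.1) := by
    ext i
    simp [Fin.ext_iff]
    omega
  rw [jwSign, this, Finset.prod_insert (by simp), jwSign]

theorem ann_apply {n : ℕ} (j : Fin n) (x y : Occ n) :
    ann j x y = if x j = false ∧ y = Function.update x j true then jwSign j.1 x else 0 := by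
  have h : (y j = true ∧ x = Function.update y j false) ↔
      (x j = false ∧ y = Function.update x j true) := by
    constructor
    · rintro ⟨h, rfl⟩
      simp [← h]
    · rintro ⟨h, rfl⟩
      simp [← h]
  simp only [ann, zString, Matrix.diagonal_mul, lower, Matrix.of_apply, h, mul_ite, mul_one,
    mul_zero, jwSign, Fin.lt_def]

theorem ann_mulVec {n : ℕ} (j : Fin n) (ψ : Ket n) (x : Occ n) :
    (ann j *ᵥ ψ) x = if x j = true then 0 else jwSign j.1 x * ψ (flipAt j x) := by
  cases h : x j <;> simp [Matrix.mulVec, dotProduct, ann_apply, h, flipAt]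

theorem ann_conjTranspose_mulVec {n : ℕ} (j : Fin n) (ψ : Ket n) (x : Occ n) :
    ((ann j)ᴴ *ᵥ ψ) x = if x j = true then jwSign j.1 x * ψ (flipAt j x) else 0 := by
  have h (y : Occ n) : (y j = false ∧ x = Function.update y j true) ↔
      (x j = true ∧ y = Function.update x j false) := by
    constructor
    · rintro ⟨h, rfl⟩
      simp [← h]
    · rintro ⟨h, rfl⟩
      simp [← h]
  simp only [Matrix.mulVec, dotProduct, Matrix.conjTranspose_apply, ann_apply, h]
  cases hx : x j
  · simp
  · simp [flipAt, hx, star_jwSign, jwSign_update_of_le, apply_ite star,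
      -RCLike.star_def]

/-- In the occupation basis a Majorana operator flips one mode, up to a Jordan–Wigner sign. The
string of `c_k` covers the first `(k + 1) / 2` modes: that of an even `k = 2p` ends before mode
`p`, that of `k = 2p + 1` includes it. -/
theorem majorana_mulVec {n : ℕ} (k : Fin (2 * n)) (ψ : Ket n) (x : Occ n) :
    (majorana k *ᵥ ψ) x = (if k.1 % 2 = 0 then 1 else -Complex.I) * jwSign ((k.1 + 1) / 2) x *
      ψ (flipAt ⟨k.1 / 2, by omega⟩ x) := by
  have hp : k.1 / 2 < n := by omega
  simp only [majorana]
  split_ifs with h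
  · have : (k.1 + 1) / 2 = k.1 / 2 := by omega
    rw [Matrix.add_mulVec, Pi.add_apply, ann_mulVec, ann_conjTranspose_mulVec, this]
    split_ifs <;> simp
  · have : (k.1 + 1) / 2 = k.1 / 2 + 1 := by omega
    have h' := jwSign_succ ⟨k.1 / 2, hp⟩ x
    simp only at h'
    rw [Matrix.smul_mulVec, Matrix.sub_mulVec, Pi.smul_apply, Pi.sub_apply, ann_mulVec,
      ann_conjTranspose_mulVec, this, h']
    split_ifs <;> simp [mul_assoc]

theorem majorana_mul_majorana_mulVec {n : ℕ} (k l : Fin (2 * n)) (ψ : Ket n) (x : Occ n) :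
    ((majorana k * majorana l) *ᵥ ψ) x =
      (if k.1 % 2 = 0 then 1 else -Complex.I) * (if l.1 % 2 = 0 then 1 else -Complex.I) *
      (if k.1 / 2 < (l.1 + 1) / 2 then -1 else 1) *
      (jwSign ((k.1 + 1) / 2) x * jwSign ((l.1 + 1) / 2) x) *
      ψ (flipAt ⟨l.1 / 2, by omega⟩ (flipAt ⟨k.1 / 2, by omega⟩ x)) := by
  rw [← Matrix.mulVec_mulVec, majorana_mulVec, majorana_mulVec, jwSign_flipAt]
  ring

theorem majorana_mul_self {n : ℕ} (k : Fin (2 * n)) : majorana k * majorana k = 1 := by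
  refine Matrix.mulVec_injective (funext fun ψ => funext fun x => ?_)
  rw [majorana_mul_majorana_mulVec, flipAt_flipAt, jwSign_mul_self, Matrix.one_mulVec]
  by_cases h : k.1 % 2 = 0
  · simp [h, show ¬ k.1 / 2 < (k.1 + 1) / 2 by omega]
  · simp [h, show k.1 / 2 < (k.1 + 1) / 2 by omega]

theorem majorana_anticomm {n : ℕ} {k l : Fin (2 * n)} (hkl : k ≠ l) :
    majorana k * majorana l = -(majorana l * majorana k) := by
  refine Matrix.mulVec_injective (funext fun ψ => funext fun x => ?_)
  rw [Matrix.neg_mulVec, Pi.neg_apply, majorana_mul_majorana_mulVec, majorana_mul_majorana_mulVec,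
    flipAt_comm]
  have hkl' : k.1 ≠ l.1 := fun h => hkl (Fin.ext h)
  rcases lt_or_gt_of_ne hkl' with h | h
  · rw [if_pos (show k.1 / 2 < (l.1 + 1) / 2 by omega),
      if_neg (show ¬ l.1 / 2 < (k.1 + 1) / 2 by omega)]
    ring
  · rw [if_neg (show ¬ k.1 / 2 < (l.1 + 1) / 2 by omega),
      if_pos (show l.1 / 2 < (k.1 + 1) / 2 by omega)]
    ring

theorem majorana_conjTranspose {n : ℕ} (k : Fin (2 * n)) : (majorana k)ᴴ = majorana k := by
  simp only [majorana]
  split_ifs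
  · simp [add_comm]
  · simp [Matrix.conjTranspose_smul, smul_sub, add_comm]

/-! ### Gaussian unitaries -/

/-- A Gaussian unitary: one that acts on the Majorana operators by an orthogonal matrix. -/
def IsGaussianUnitary {n : ℕ} (U : Op n) : Prop :=
  U ∈ Matrix.unitaryGroup (Occ n) ℂ ∧ ∃ R ∈ Matrix.orthogonalGroup (Fin (2 * n)) ℝ,
    ∀ p, Uᴴ * majorana p * U = ∑ q, ((R p q : ℝ) : ℂ) • majorana q

theorem IsGaussianUnitary.isGaussian {n : ℕ} {U : Op n} (h : IsGaussianUnitary U) :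
    IsGaussian (U *ᵥ vacuum n) := by
  obtain ⟨hU, R, hR, h⟩ := h
  exact ⟨R, hR, U, hU, h, rfl⟩

theorem isGaussianUnitary_one (n : ℕ) : IsGaussianUnitary (1 : Op n) := by
  refine ⟨one_mem _, 1, one_mem _, fun p => ?_⟩
  simp [Matrix.one_apply]

theorem IsGaussianUnitary.mul {n : ℕ} {U V : Op n} (hU : IsGaussianUnitary U)
    (hV : IsGaussianUnitary V) : IsGaussianUnitary (U * V) := by
  obtain ⟨hU, R, hR, hUR⟩ := hU
  obtain ⟨hV, S, hS, hVS⟩ := hV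
  refine ⟨mul_mem hU hV, R * S, mul_mem hR hS, fun p => ?_⟩
  calc (U * V)ᴴ * majorana p * (U * V) = Vᴴ * (Uᴴ * majorana p * U) * V := by
        simp only [Matrix.conjTranspose_mul, mul_assoc]
    _ = ∑ q, ((R p q : ℝ) : ℂ) • ∑ r, ((S q r : ℝ) : ℂ) • majorana r := by
        simp only [hUR, Finset.mul_sum, Finset.sum_mul, mul_smul_comm, smul_mul_assoc, hVS]
    _ = _ := by
        simp only [Finset.smul_sum, smul_smul, Matrix.mul_apply, Complex.ofReal_sum,
          Complex.ofReal_mul, Finset.sum_smul]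
        exact Finset.sum_comm

/-- The rotation `exp (π/4 · c_k c_l) = (1 + c_k c_l) / √2` in the plane of `c_k` and `c_l`. -/
noncomputable def quarterTurn {n : ℕ} (k l : Fin (2 * n)) : Op n :=
  ((√2)⁻¹ : ℂ) • (1 + majorana k * majorana l)

theorem quarterTurn_conjTranspose {n : ℕ} {k l : Fin (2 * n)} (hkl : k ≠ l) :
    (quarterTurn k l)ᴴ = ((√2)⁻¹ : ℂ) • (1 - majorana k * majorana l) := by
  simp [quarterTurn, Matrix.conjTranspose_smul, majorana_conjTranspose, majorana_anticomm hkl.symm,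
    sub_eq_add_neg]

theorem inv_sqrt_two_mul_self : ((√2)⁻¹ : ℂ) * ((√2)⁻¹ : ℂ) = 1 / 2 := by
  rw [← mul_inv, ← Complex.ofReal_mul, Real.mul_self_sqrt zero_le_two]
  norm_num

theorem quarterTurn_conj {n : ℕ} {k l : Fin (2 * n)} (hkl : k ≠ l) (X : Op n) :
    (quarterTurn k l)ᴴ * X * quarterTurn k l =
      (1 / 2 : ℂ) • ((1 - majorana k * majorana l) * X * (1 + majorana k * majorana l)) := by
  rw [quarterTurn_conjTranspose hkl, quarterTurn]
  simp only [smul_mul_assoc, mul_smul_comm, smul_smul, inv_sqrt_two_mul_self]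

theorem isGaussianUnitary_quarterTurn {n : ℕ} {k l : Fin (2 * n)} (hkl : k ≠ l) :
    IsGaussianUnitary (quarterTurn k l) := by
  set A := majorana k with hA
  set B := majorana l with hB
  have hAA : A * A = 1 := majorana_mul_self k
  have hBB : B * B = 1 := majorana_mul_self l
  have hBA : B * A = -(A * B) := majorana_anticomm hkl.symm
  have hABA : A * B * A = -B := by rw [mul_assoc, hBA, mul_neg, ← mul_assoc, hAA, one_mul]
  have hBAB : B * (A * B) = -A := by rw [← mul_assoc, hBA, neg_mul, mul_assoc, hBB, mul_one]
  have hABAB : A * B * (A * B) = -1 := by rw [← mul_assoc, hABA, neg_mul, hBB]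
  refine ⟨?_, ?_⟩
  · rw [Matrix.mem_unitaryGroup_iff', Matrix.star_eq_conjTranspose]
    have h := quarterTurn_conj hkl (1 : Op n)
    rw [mul_one] at h
    rw [h, ← hA, ← hB, mul_one, sub_mul, one_mul, mul_add, mul_one, hABAB,
      show (1 + A * B - (A * B + -1) : Op n) = (2 : ℂ) • 1 by rw [two_smul]; abel, smul_smul]
    norm_num
  -- `c_k ↦ c_l`, `c_l ↦ -c_k`, and all other Majorana operators are fixed.
  · set s : Fin (2 * n) → ℝ := fun p => if p = l then -1 else 1 with hs
    refine ⟨Matrix.of fun p q => if q = Equiv.swap k l p then s p else 0, ?_, fun p => ?_⟩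
    · rw [Matrix.mem_orthogonalGroup_iff]
      ext p q
      simp only [Matrix.mul_apply, Matrix.of_apply, ite_mul, zero_mul, Finset.sum_ite_eq',
        Finset.mem_univ, if_true, Matrix.one_apply]
      rcases eq_or_ne p q with rfl | h
      · by_cases hp : p = l <;> simp [hs, hp]
      · simp [h]
    · rw [quarterTurn_conj hkl, ← hA, ← hB]
      simp only [Matrix.of_apply, apply_ite Complex.ofReal, ite_smul, Complex.ofReal_zero,
        zero_smul, Finset.sum_ite_eq', Finset.mem_univ, if_true]
      rcases eq_or_ne p k with rfl | hpk
      · rw [Equiv.swap_apply_left, ← hA, ← hB, sub_mul, one_mul, hABA, sub_neg_eq_add, add_mul,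
          mul_add, mul_add, mul_one, mul_one, hBAB, ← mul_assoc A, hAA, one_mul,
          show A + B + (B + -A) = (2 : ℂ) • B by rw [two_smul]; abel, smul_smul]
        simp [hs, hkl]
      rcases eq_or_ne p l with rfl | hpl
      · rw [Equiv.swap_apply_right, ← hA, ← hB, sub_mul, one_mul, mul_assoc A, hBB, mul_one,
          sub_mul, mul_add, mul_add, mul_one, mul_one, hBAB, ← mul_assoc A, hAA, one_mul,
          show B + -A - (A + B) = (-2 : ℂ) • A by rw [neg_smul, two_smul]; abel, smul_smul]
        simp [hs]
      · rw [Equiv.swap_apply_of_ne_of_ne hpk hpl]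
        set C := majorana p
        have hCA : C * A = -(A * C) := majorana_anticomm hpk
        have hCB : C * B = -(B * C) := majorana_anticomm hpl
        have hCAB : C * (A * B) = A * B * C := by
          rw [← mul_assoc, hCA, neg_mul, mul_assoc, hCB, mul_neg, neg_neg, mul_assoc]
        rw [mul_assoc, mul_add, mul_one, hCAB, mul_add, sub_mul, sub_mul, one_mul, one_mul,
          ← mul_assoc (A * B), hABAB,
          show C - A * B * C + (A * B * C - -1 * C) = (2 : ℂ) • C by
            rw [two_smul, neg_one_mul]; abel, smul_smul]
        simp [hs, hpl]

/-! ### Gaussian states form a compact set -/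

theorem isCompact_unitaryGroup {m 𝕜 : Type*} [Fintype m] [DecidableEq m] [RCLike 𝕜] :
    IsCompact (Matrix.unitaryGroup m 𝕜 : Set (Matrix m m 𝕜)) := by
  have hc : IsCompact (Set.univ.pi fun _ : m => Set.univ.pi fun _ : m =>
      Metric.closedBall (0 : 𝕜) 1) :=
    isCompact_univ_pi fun _ => isCompact_univ_pi fun _ => isCompact_closedBall _ _
  refine IsCompact.of_isClosed_subset hc ?_ fun U hU i _ j _ => ?_
  · have : (Matrix.unitaryGroup m 𝕜 : Set (Matrix m m 𝕜)) = {U | U * Uᴴ = 1} := by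
      ext U
      exact Matrix.mem_unitaryGroup_iff
    rw [this]
    exact isClosed_eq (by fun_prop) continuous_const
  · simpa using entry_norm_bound_of_unitary hU i j

theorem isCompact_gaussianEnergies {n : ℕ} (h : Op n) : IsCompact (gaussianEnergies h) := by
  have hK : IsCompact
      {x : Matrix (Fin (2 * n)) (Fin (2 * n)) ℝ × Op n |
        x ∈ (Matrix.orthogonalGroup (Fin (2 * n)) ℝ : Set _) ×ˢ
          (Matrix.unitaryGroup (Occ n) ℂ : Set _) ∧
        ∀ p, x.2ᴴ * majorana p * x.2 = ∑ q, ((x.1 p q : ℝ) : ℂ) • majorana q} := by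
    refine (isCompact_unitaryGroup.prod isCompact_unitaryGroup).inter_right (t := {x |
      ∀ p, x.2ᴴ * majorana p * x.2 = ∑ q, ((x.1 p q : ℝ) : ℂ) • majorana q}) ?_
    rw [Set.ofPred_forall]
    refine isClosed_iInter fun p => isClosed_eq (by fun_prop) ?_
    refine continuous_finsetSum _ fun q _ => ?_
    exact (Complex.continuous_ofReal.comp (continuous_fst.matrix_elem p q)).smul continuous_const
  have hf : Continuous fun x : Matrix (Fin (2 * n)) (Fin (2 * n)) ℝ × Op n =>
      energy h (x.2 *ᵥ vacuum n) := by
    unfold energy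
    fun_prop
  convert hK.image hf using 1
  ext e
  constructor
  · rintro ⟨ψ, ⟨R, hR, U, hU, hRU, rfl⟩, rfl⟩
    exact ⟨(R, U), ⟨⟨hR, hU⟩, hRU⟩, rfl⟩
  · rintro ⟨⟨R, U⟩, ⟨⟨hR, hU⟩, hRU⟩, rfl⟩
    exact ⟨_, ⟨R, hR, U, hU, hRU, rfl⟩, rfl⟩

theorem isGreatest_lambdaGauss {n : ℕ} (h : Op n) :
    IsGreatest (gaussianEnergies h) (lambdaGauss h) :=
  (isCompact_gaussianEnergies h).isGreatest_sSup
    ⟨_, _, (isGaussianUnitary_one n).isGaussian, rfl⟩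

/-! ### Pairs of modes and Richardson's Hamiltonian -/

/-- The first mode of the `j`-th pair. -/
def fstMode {n : ℕ} (j : Fin (n / 2)) : Fin n := ⟨2 * j.1, by omega⟩

/-- The second mode of the `j`-th pair. -/
def sndMode {n : ℕ} (j : Fin (n / 2)) : Fin n := ⟨2 * j.1 + 1, by omega⟩

/-- The occupation pattern obtained from `x` by changing both modes of the `j`-th pair. -/
def flipPair {n : ℕ} (j : Fin (n / 2)) (x : Occ n) : Occ n :=
  flipAt (fstMode j) (flipAt (sndMode j) x)

theorem flipPair_involutive {n : ℕ} (j : Fin (n / 2)) : Function.Involutive (flipPair j) := by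
  intro x
  rw [flipPair, flipPair, flipAt_comm (sndMode j), flipAt_flipAt, flipAt_flipAt]

theorem flipPair_fstMode {n : ℕ} (j i : Fin (n / 2)) (x : Occ n) :
    flipPair j x (fstMode i) = if i = j then !x (fstMode i) else x (fstMode i) := by
  have h : ¬ (2 * i.1 = 2 * j.1 + 1) := by omega
  have h' : ¬ (2 * j.1 = 2 * j.1 + 1) := by omega
  by_cases hij : i = j
  · subst hij
    simp [flipPair, flipAt, fstMode, sndMode]
  · simp [flipPair, flipAt, fstMode, sndMode, h, hij, ← Fin.ext_iff]

theorem flipPair_sndMode {n : ℕ} (j i : Fin (n / 2)) (x : Occ n) :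
    flipPair j x (sndMode i) = if i = j then !x (sndMode i) else x (sndMode i) := by
  have h : ¬ (2 * i.1 + 1 = 2 * j.1) := by omega
  by_cases hij : i = j
  · subst hij
    simp [flipPair, flipAt, fstMode, sndMode]
  · simp [flipPair, flipAt, fstMode, sndMode, h, hij, ← Fin.ext_iff]

/-- The `j`-th pair of modes is empty in `x`. -/
abbrev EmptyPair {n : ℕ} (x : Occ n) (j : Fin (n / 2)) : Prop :=
  x (fstMode j) = false ∧ x (sndMode j) = false

/-- The `j`-th pair of modes is doubly occupied in `x`. -/
abbrev FullPair {n : ℕ} (x : Occ n) (j : Fin (n / 2)) : Prop :=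
  x (fstMode j) = true ∧ x (sndMode j) = true

theorem emptyPair_flipPair {n : ℕ} (x : Occ n) (j : Fin (n / 2)) :
    EmptyPair (flipPair j x) j ↔ FullPair x j := by
  simp [EmptyPair, FullPair, flipPair_fstMode, flipPair_sndMode]

theorem emptyPair_flipPair_of_ne {n : ℕ} (x : Occ n) {i j : Fin (n / 2)} (h : i ≠ j) :
    EmptyPair (flipPair j x) i ↔ EmptyPair x i := by
  simp [EmptyPair, flipPair_fstMode, flipPair_sndMode, h]

theorem flipAt_sndMode_fstMode {n : ℕ} (j : Fin (n / 2)) (x : Occ n) :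
    flipAt (sndMode j) x (fstMode j) = x (fstMode j) := by
  simp [flipAt, fstMode, sndMode]

theorem flipAt_fstMode_sndMode {n : ℕ} (j : Fin (n / 2)) (x : Occ n) :
    flipAt (fstMode j) x (sndMode j) = x (sndMode j) := by
  simp [flipAt, fstMode, sndMode]

/-- Inside a pair the two Jordan–Wigner strings cancel up to a sign that does not depend on the
pair. -/
theorem pairOp_mulVec {n : ℕ} (ψ : Ket n) (x : Occ n) :
    (pairOp n *ᵥ ψ) x = -∑ j, if EmptyPair x j then ψ (flipPair j x) else 0 := by
  rw [pairOp, Matrix.sum_mulVec, Finset.sum_apply, ← Finset.sum_neg_distrib]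
  refine Finset.sum_congr rfl fun j _ => ?_
  change ((ann (fstMode j) * ann (sndMode j)) *ᵥ ψ) x = _
  rw [← Matrix.mulVec_mulVec, ann_mulVec, ann_mulVec, jwSign_flipAt, flipAt_fstMode_sndMode,
    show (sndMode j).1 = (fstMode j).1 + 1 from rfl, jwSign_succ, flipAt_comm]
  rcases Bool.eq_false_or_eq_true (x (fstMode j)) with h | h <;>
    rcases Bool.eq_false_or_eq_true (x (sndMode j)) with h' | h' <;>
    simp [flipPair, EmptyPair, h, h', ← mul_assoc, jwSign_mul_self]

theorem pairOp_conjTranspose_mulVec {n : ℕ} (ψ : Ket n) (x : Occ n) :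
    ((pairOp n)ᴴ *ᵥ ψ) x = -∑ j, if FullPair x j then ψ (flipPair j x) else 0 := by
  rw [pairOp, Matrix.conjTranspose_sum, Matrix.sum_mulVec, Finset.sum_apply,
    ← Finset.sum_neg_distrib]
  refine Finset.sum_congr rfl fun j _ => ?_
  change ((ann (fstMode j) * ann (sndMode j))ᴴ *ᵥ ψ) x = _
  rw [Matrix.conjTranspose_mul, ← Matrix.mulVec_mulVec, ann_conjTranspose_mulVec,
    ann_conjTranspose_mulVec, jwSign_flipAt, flipAt_sndMode_fstMode,
    show (sndMode j).1 = (fstMode j).1 + 1 from rfl, jwSign_succ]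
  rcases Bool.eq_false_or_eq_true (x (fstMode j)) with h | h <;>
    rcases Bool.eq_false_or_eq_true (x (sndMode j)) with h' | h' <;>
    simp [flipPair, FullPair, h, h', ← mul_assoc, jwSign_mul_self]

theorem richardson_mulVec {n : ℕ} (ψ : Ket n) (x : Occ n) :
    (richardson n *ᵥ ψ) x = ∑ j, if FullPair x j then
      ∑ i, if EmptyPair (flipPair j x) i then ψ (flipPair i (flipPair j x)) else 0 else 0 := by
  rw [richardson, ← Matrix.mulVec_mulVec, pairOp_conjTranspose_mulVec, ← Finset.sum_neg_distrib]
  refine Finset.sum_congr rfl fun j _ => ?_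
  split_ifs <;> simp [pairOp_mulVec]

/-! ### Bounds on the largest eigenvalue -/

/-- The row of `h` at a pattern with `D` full and `E` empty pairs has sum `D (E + 1)`: a full pair
is emptied, and one of the `E + 1` pairs that are now empty is filled. Here `D + E ≤ n / 2`. -/
theorem card_fullPair_mul_le {n : ℕ} (x : Occ n) :
    ∑ j, (if FullPair x j then ∑ i, if EmptyPair (flipPair j x) i then (1 : ℝ) else 0 else 0) ≤
      ((n / 2 : ℕ) + 1) ^ 2 / 4 := by
  set D := Finset.univ.filter fun j => FullPair x j
  set E := Finset.univ.filter fun j => EmptyPair x j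
  have hDE : Disjoint D E := by
    rw [Finset.disjoint_filter]
    rintro j - h h'
    exact Bool.noConfusion (h.1.symm.trans h'.1)
  have hcard : (D.card : ℝ) + E.card ≤ (n / 2 : ℕ) := by
    have := Finset.card_le_univ (D ∪ E)
    rw [Finset.card_union_of_disjoint hDE, Fintype.card_fin] at this
    exact_mod_cast this
  have hrow (j : Fin (n / 2)) :
      ∑ i, (if EmptyPair (flipPair j x) i then (1 : ℝ) else 0) ≤ E.card + 1 := by
    rw [Finset.sum_boole]
    have : (Finset.univ.filter fun i => EmptyPair (flipPair j x) i) ⊆ insert j E := by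
      intro i hi
      by_cases hij : i = j
      · simp [hij]
      · have := (emptyPair_flipPair_of_ne x hij).1 (Finset.mem_filter.1 hi).2
        exact Finset.mem_insert_of_mem (Finset.mem_filter.2 ⟨Finset.mem_univ _, this⟩)
    exact_mod_cast (Finset.card_le_card this).trans (Finset.card_insert_le _ _)
  calc _ ≤ ∑ j, if FullPair x j then (E.card + 1 : ℝ) else 0 := by
        gcongr with j
        split_ifs
        · exact hrow j
        · rfl
    _ = D.card * (E.card + 1) := by
        rw [← Finset.sum_filter, Finset.sum_const, nsmul_eq_mul]
    _ ≤ _ := by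
        have : (0 : ℝ) ≤ D.card := by positivity
        have : (0 : ℝ) ≤ E.card := by positivity
        nlinarith [sq_nonneg ((D.card : ℝ) - (E.card + 1))]

/-- The eigenvalue equation at an entry of largest modulus bounds the eigenvalue by a row sum. -/
theorem realEigenvalue_le {n : ℕ} {μ : ℝ} (hμ : μ ∈ realEigenvalues (richardson n)) :
    μ ≤ ((n / 2 : ℕ) + 1) ^ 2 / 4 := by
  obtain ⟨v, hv⟩ := Module.End.HasEigenvalue.exists_hasEigenvector hμ
  have hvv : richardson n *ᵥ v = (μ : ℂ) • v := hv.apply_eq_smul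
  obtain ⟨x, hx⟩ := Finite.exists_max fun x => ‖v x‖
  have hpos : 0 < ‖v x‖ := by
    obtain ⟨y, hy⟩ := Function.ne_iff.1 hv.2
    exact (norm_pos_iff.2 hy).trans_le (hx y)
  have key : |μ| * ‖v x‖ ≤ ((n / 2 : ℕ) + 1) ^ 2 / 4 * ‖v x‖ := by
    calc |μ| * ‖v x‖ = ‖(richardson n *ᵥ v) x‖ := by simp [hvv]
      _ ≤ ∑ j, (if FullPair x j then
            ∑ i, if EmptyPair (flipPair j x) i then (1 : ℝ) else 0 else 0) * ‖v x‖ := by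
          rw [richardson_mulVec]
          refine norm_sum_le_of_le _ fun j _ => ?_
          split_ifs
          · rw [Finset.sum_mul]
            refine norm_sum_le_of_le _ fun i _ => ?_
            split_ifs
            · simpa using hx _
            · simp
          · simp
      _ ≤ _ := by
          rw [← Finset.sum_mul]
          gcongr
          exact card_fullPair_mul_le x
  exact (le_abs_self μ).trans (le_of_mul_le_mul_right key hpos)

theorem eigenvalues_mem_realEigenvalues {n : ℕ} {h : Op n} (hh : h.IsHermitian) (i : Occ n) :
    hh.eigenvalues i ∈ realEigenvalues h := by
  refine Module.End.hasEigenvalue_of_hasEigenvector (x := ⇑(hh.eigenvectorBasis i))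
    ⟨Module.End.mem_eigenspace_iff.2 ?_, fun h0 => ?_⟩
  · simpa using hh.mulVec_eigenvectorBasis i
  · exact hh.eigenvectorBasis.orthonormal.ne_zero i (by ext x; exact congrFun h0 x)

theorem finite_realEigenvalues {n : ℕ} (h : Op n) : (realEigenvalues h).Finite :=
  (Module.End.finite_hasEigenvalue (Matrix.toLin' h)).preimage Complex.ofReal_injective.injOn

theorem isGreatest_lambdaMax {n : ℕ} {h : Op n} (hh : h.IsHermitian) :
    IsGreatest (realEigenvalues h) (lambdaMax h) :=
  (finite_realEigenvalues h).isCompact.isGreatest_sSup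
    ⟨_, eigenvalues_mem_realEigenvalues hh fun _ => false⟩

open scoped ComplexOrder in
theorem lambdaMax_pos {n : ℕ} {h : Op n} (hh : h.PosSemidef) (h0 : h ≠ 0) : 0 < lambdaMax h := by
  obtain ⟨i, hi⟩ : ∃ i, hh.isHermitian.eigenvalues i ≠ 0 :=
    Function.ne_iff.1 (mt hh.isHermitian.eigenvalues_eq_zero_iff.1 h0)
  exact ((hh.eigenvalues_nonneg i).lt_of_ne' hi).trans_le
    ((isGreatest_lambdaMax hh.isHermitian).2 (eigenvalues_mem_realEigenvalues _ i))

theorem richardson_isHermitian (n : ℕ) : (richardson n).IsHermitian :=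
  Matrix.isHermitian_conjTranspose_mul_self _

open scoped ComplexOrder in
theorem lambdaMax_richardson_pos {n : ℕ} (h0 : richardson n ≠ 0) :
    0 < lambdaMax (richardson n) :=
  lambdaMax_pos (Matrix.posSemidef_conjTranspose_mul_self _) h0

/-! ### The BCS state -/

/-- Patterns in which both modes of each pair are equally occupied, and the pairs from the `m`-th
on are empty. -/
def IsPaired {n : ℕ} (m : ℕ) (x : Occ n) : Prop :=
  ∀ j : Fin (n / 2), x (fstMode j) = x (sndMode j) ∧ (m ≤ j.1 → x (fstMode j) = false)

theorem isPaired_flipPair {n m : ℕ} {j : Fin (n / 2)} (h : j.1 < m) (x : Occ n) :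
    IsPaired m (flipPair j x) ↔ IsPaired m x := by
  refine forall_congr' fun i => ?_
  rw [flipPair_fstMode, flipPair_sndMode]
  split_ifs with hij
  · subst hij
    simp [h]
  · rfl

theorem isPaired_iff_succ {n : ℕ} (j : Fin (n / 2)) (x : Occ n) :
    IsPaired j.1 x ↔ IsPaired (j.1 + 1) x ∧ x (fstMode j) = false := by
  constructor
  · intro h
    exact ⟨fun i => ⟨(h i).1, fun hi => (h i).2 (by omega)⟩, (h j).2 le_rfl⟩
  · rintro ⟨h, hj⟩ i
    refine ⟨(h i).1, fun hi => ?_⟩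
    rcases hi.eq_or_lt with hi | hi
    · rwa [← Fin.ext hi]
    · exact (h i).2 hi

/-- The quarter turn in the plane of the first Majorana operators of the two modes of a pair. It
maps the empty pair to `(|00⟩ + |11⟩) / √2`. -/
noncomputable def pairTurn {n : ℕ} (j : Fin (n / 2)) : Op n :=
  quarterTurn ⟨4 * j.1, by omega⟩ ⟨4 * j.1 + 2, by omega⟩

theorem pairTurn_mulVec {n : ℕ} (j : Fin (n / 2)) (ψ : Ket n) (x : Occ n) :
    (pairTurn j *ᵥ ψ) x =
      (√2 : ℂ)⁻¹ * (ψ x - (if x (fstMode j) = true then -1 else 1) * ψ (flipPair j x)) := by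
  have h₁ : (⟨4 * j.1 / 2, by omega⟩ : Fin n) = fstMode j := by
    simp only [fstMode, Fin.mk.injEq]; omega
  have h₂ : (⟨(4 * j.1 + 2) / 2, by omega⟩ : Fin n) = sndMode j := by
    simp only [sndMode, Fin.mk.injEq]; omega
  have h₃ : (4 * j.1 + 1) / 2 = (fstMode j).1 := by simp only [fstMode]; omega
  have h₄ : (4 * j.1 + 2 + 1) / 2 = (fstMode j).1 + 1 := by simp only [fstMode]; omega
  rw [pairTurn, quarterTurn, Matrix.smul_mulVec, Matrix.add_mulVec, Pi.smul_apply, Pi.add_apply,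
    Matrix.one_mulVec, majorana_mul_majorana_mulVec, h₁, h₂, flipAt_comm]
  simp only [h₃, h₄, jwSign_succ]
  rw [if_pos (by omega), if_pos (by omega), if_pos (by simp only [fstMode]; omega),
    mul_left_comm (jwSign _ _), jwSign_mul_self, smul_eq_mul, flipPair]
  ring

open Classical in
/-- The quarter turns of the first `m` pairs map the vacuum to the uniform superposition of the
patterns that are paired on these pairs. -/
theorem exists_isGaussianUnitary_mulVec_vacuum {n : ℕ} (heven : Even n) (m : ℕ) (hm : m ≤ n / 2) :
    ∃ U : Op n, IsGaussianUnitary U ∧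
      ∀ x, (U *ᵥ vacuum n) x = (√2 : ℂ)⁻¹ ^ m * if IsPaired m x then 1 else 0 := by
  induction m with
  | zero =>
    refine ⟨1, isGaussianUnitary_one n, fun x => ?_⟩
    have : IsPaired 0 x ↔ x = fun _ => false := by
      constructor
      · intro h
        funext i
        have hi : i.1 / 2 < n / 2 := by
          obtain ⟨k, rfl⟩ := heven
          omega
        obtain ⟨h₁, h₂⟩ := h ⟨i.1 / 2, hi⟩
        rcases Nat.mod_two_eq_zero_or_one i.1 with hmod | hmod
        · rw [← h₂ (Nat.zero_le _)]
          congr 1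
          simp only [fstMode, Fin.ext_iff]
          omega
        · rw [← h₂ (Nat.zero_le _), h₁]
          congr 1
          simp only [sndMode, Fin.ext_iff]
          omega
      · rintro rfl j
        simp
    simp [vacuum, Matrix.one_apply, this]
  | succ m ih =>
    obtain ⟨U, hU, hUx⟩ := ih (by omega)
    let j : Fin (n / 2) := ⟨m, hm⟩
    have hne : (⟨4 * j.1, by omega⟩ : Fin (2 * n)) ≠ ⟨4 * j.1 + 2, by omega⟩ := by simp
    refine ⟨pairTurn j * U, (isGaussianUnitary_quarterTurn hne).mul hU, fun x => ?_⟩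
    rw [← Matrix.mulVec_mulVec, pairTurn_mulVec, hUx, hUx, isPaired_iff_succ j x,
      isPaired_iff_succ j (flipPair j x), isPaired_flipPair (Nat.lt_succ_self _),
      flipPair_fstMode, if_pos rfl, pow_succ]
    change _ = _ * if IsPaired (j.1 + 1) x then 1 else 0
    by_cases hp : IsPaired (j.1 + 1) x
    · rcases Bool.eq_false_or_eq_true (x (fstMode j)) with h | h <;> simp [hp, h, mul_comm]
    · simp [hp]

theorem sum_normSq_mulVec_vacuum {n : ℕ} {U : Op n} (hU : U ∈ Matrix.unitaryGroup (Occ n) ℂ) :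
    ∑ x, Complex.normSq ((U *ᵥ vacuum n) x) = 1 := by
  have h : star (U *ᵥ vacuum n) ⬝ᵥ (U *ᵥ vacuum n) = 1 := by
    rw [Matrix.star_mulVec, Matrix.dotProduct_mulVec, Matrix.vecMul_vecMul,
      ← Matrix.star_eq_conjTranspose, Matrix.mem_unitaryGroup_iff'.1 hU, Matrix.vecMul_one]
    simp [vacuum]
  have h' : ((∑ x, Complex.normSq ((U *ᵥ vacuum n) x) : ℝ) : ℂ) = 1 := by
    rw [← h]
    simp [dotProduct, Complex.normSq_eq_conj_mul_self]
  exact_mod_cast h'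

theorem energy_richardson {n : ℕ} (ψ : Ket n) :
    energy (richardson n) ψ = ∑ x, Complex.normSq ((pairOp n *ᵥ ψ) x) := by
  rw [energy, richardson, ← Matrix.mulVec_mulVec, Matrix.dotProduct_mulVec, ← Matrix.star_mulVec]
  simp [dotProduct, ← Complex.normSq_eq_conj_mul_self]

/-- The number of empty pairs of `x`. -/
def emptyPairs {n : ℕ} (x : Occ n) : ℝ := ∑ j, if EmptyPair x j then 1 else 0

/-- If the weights are supported on paired patterns and do not change when a pair is flipped, each
pair is empty with probability `1 / 2`. -/
theorem sum_emptyPairs_mul {n : ℕ} {w : Occ n → ℝ} (hw : ∀ j x, w (flipPair j x) = w x)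
    (hs : ∀ j x, x (fstMode j) ≠ x (sndMode j) → w x = 0) :
    ∑ x, emptyPairs x * w x = (n / 2 : ℕ) / 2 * ∑ x, w x := by
  have key (j : Fin (n / 2)) : ∑ x, (if EmptyPair x j then w x else 0) = 1 / 2 * ∑ x, w x := by
    have hflip : ∑ x, (if EmptyPair x j then w x else 0) =
        ∑ x, if FullPair x j then w x else 0 := by
      rw [← Equiv.sum_comp (flipPair_involutive j).toPerm]
      simp only [Function.Involutive.coe_toPerm, emptyPair_flipPair, hw]
    have hadd : ∑ x, (if EmptyPair x j then w x else 0) + ∑ x, (if FullPair x j then w x else 0) =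
        ∑ x, w x := by
      rw [← Finset.sum_add_distrib]
      refine Finset.sum_congr rfl fun x _ => ?_
      have := hs j x
      rcases Bool.eq_false_or_eq_true (x (fstMode j)) with h | h <;>
        rcases Bool.eq_false_or_eq_true (x (sndMode j)) with h' | h' <;>
        simp_all [EmptyPair, FullPair]
    linarith
  simp only [emptyPairs, Finset.sum_mul, ite_mul, one_mul, zero_mul]
  rw [Finset.sum_comm, Finset.sum_congr rfl fun j _ => key j, Finset.sum_const, Finset.card_univ,
    Fintype.card_fin, nsmul_eq_mul]
  ring

/-- The mean of `E²` is at least the square `(n / 4)²` of the mean of the number `E` of empty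
pairs. -/
theorem exists_gaussian_energy_ge {n : ℕ} (heven : Even n) :
    ∃ ψ : Ket n, IsGaussian ψ ∧ ((n / 2 : ℕ) : ℝ) ^ 2 / 4 ≤ energy (richardson n) ψ := by
  classical
  obtain ⟨U, hU, hUx⟩ := exists_isGaussianUnitary_mulVec_vacuum heven (n / 2) le_rfl
  refine ⟨_, hU.isGaussian, ?_⟩
  have hnorm := sum_normSq_mulVec_vacuum hU.1
  set ψ := U *ᵥ vacuum n
  have hflip (j : Fin (n / 2)) (x : Occ n) : ψ (flipPair j x) = ψ x := by
    rw [hUx, hUx, isPaired_flipPair j.2]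
  have hmean := sum_emptyPairs_mul (w := fun x => Complex.normSq (ψ x))
    (fun j x => by rw [hflip]) fun j x hx => by
      rw [hUx, if_neg fun h => hx (h j).1]
      simp
  rw [hnorm, mul_one] at hmean
  have hP (x : Occ n) : (pairOp n *ᵥ ψ) x = -(emptyPairs x : ℂ) * ψ x := by
    rw [pairOp_mulVec]
    simp [hflip, emptyPairs, Finset.sum_mul, apply_ite Complex.ofReal, -Finset.sum_boole]
  rw [energy_richardson]
  set N : ℝ := ((n / 2 : ℕ) : ℝ)
  calc N ^ 2 / 4 = N * ∑ x, emptyPairs x * Complex.normSq (ψ x)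
        - N ^ 2 / 4 * ∑ x, Complex.normSq (ψ x) := by rw [hmean, hnorm]; ring
    _ = ∑ x, (N * emptyPairs x - N ^ 2 / 4) * Complex.normSq (ψ x) := by
        rw [Finset.mul_sum, Finset.mul_sum, ← Finset.sum_sub_distrib]
        exact Finset.sum_congr rfl fun x _ => by ring
    _ ≤ ∑ x, Complex.normSq ((pairOp n *ᵥ ψ) x) := by
        refine Finset.sum_le_sum fun x _ => ?_
        rw [hP, Complex.normSq_mul, Complex.normSq_neg, Complex.normSq_ofReal]
        refine mul_le_mul_of_nonneg_right ?_ (Complex.normSq_nonneg _)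
        nlinarith [sq_nonneg (emptyPairs x - N / 2)]

theorem richardson_ne_zero {n : ℕ} (hn : 2 ≤ n) (heven : Even n) : richardson n ≠ 0 := by
  intro h
  obtain ⟨ψ, -, hψ⟩ := exists_gaussian_energy_ge heven
  have : 0 < n / 2 := by omega
  have : (0 : ℝ) < (n / 2 : ℕ) := by exact_mod_cast this
  have : (0 : ℝ) < ((n / 2 : ℕ) : ℝ) ^ 2 / 4 := by positivity
  simp [h, energy] at hψ
  linarith

end Fermion

/-- Both maxima are attained, and their ratio is at least `1 - 6/n`. -/
theorem lemma5 (n : ℕ) (hn : 8 ≤ n) (heven : Even n) :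
    IsGreatest (Fermion.gaussianEnergies (Fermion.richardson n))
        (Fermion.lambdaGauss (Fermion.richardson n)) ∧
      IsGreatest (Fermion.realEigenvalues (Fermion.richardson n))
        (Fermion.lambdaMax (Fermion.richardson n)) ∧
      Fermion.lambdaGauss (Fermion.richardson n) / Fermion.lambdaMax (Fermion.richardson n)
        ≥ 1 - 6 / (n : ℝ) := by
  have hG := Fermion.isGreatest_lambdaGauss (Fermion.richardson n)
  have hM := Fermion.isGreatest_lambdaMax (Fermion.richardson_isHermitian n)
  refine ⟨hG, hM, ?_⟩
  have hpos := Fermion.lambdaMax_richardson_pos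
    (Fermion.richardson_ne_zero (by omega) heven)
  have hle := Fermion.realEigenvalue_le hM.1
  obtain ⟨ψ, hψ, hge⟩ := Fermion.exists_gaussian_energy_ge heven
  have hge' := hge.trans (hG.2 ⟨ψ, hψ, rfl⟩)
  obtain ⟨N, rfl⟩ := heven.exists_two_nsmul
  simp only [smul_eq_mul, Nat.mul_div_cancel_left N two_pos] at *
  have hN : (4 : ℝ) ≤ N := by exact_mod_cast (by omega : 4 ≤ N)
  rw [ge_iff_le, le_div_iff₀ hpos]
  have h3 : 1 - 6 / ((2 * N : ℕ) : ℝ) = (N - 3) / N := by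
    push_cast
    field_simp
    ring
  rw [h3]
  refine le_trans ?_ hge'
  calc (N - 3) / N * Fermion.lambdaMax (Fermion.richardson (2 * N))
      ≤ (N - 3) / N * (((N : ℝ) + 1) ^ 2 / 4) :=
        mul_le_mul_of_nonneg_left hle (div_nonneg (by linarith) (by linarith))
    _ ≤ (N : ℝ) ^ 2 / 4 := by
        rw [div_mul_eq_mul_div, div_le_iff₀ (by linarith)]
        nlinarith
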